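/- Let $N$ parties hold systems with Hilbert spaces $\mathbb{C}^{d_1},\dots,\mathbb{C}^{d_N}$, and let $\mathbf{k}=(k_1,\dots,k_N)$ be integers with $k_q\ge 1$. Whenever $k_q\le d_q$ for all $q$, define, for a (not necessarily normalized) pure state $\psi\in\mathbb{C}^{d_1}\otimes\cdots\otimes\mathbb{C}^{d_N}$, $$E_{\mathbf{k}}(\psi)=\max_{\Gamma_1,\dots,\Gamma_N}\bigl\|(\Gamma_1\otimes\cdots\otimes\Gamma_N)\psi\bigr\|^2,$$ where $\Gamma_q$ ranges over the orthogonal projectors of rank $k_q$ on $\mathbb{C}^{d_q}$. For a positive semidefinite operator $\rho$ (an unnormalized mixed state) let $$E_{\mathbf{k}}(\rho)=\max\Bigl\{\sum_i E_{\mathbf{k}}(\psi_i)\;:\;\sum_i|\psi_i\rangle\langle\psi_i|=\rho\Bigr\},$$ the maximum being over finite families $(\psi_i)$ of unnormalized vectors. For a finite ensemble $\{p_i,\rho_i\}$ with weights $p_i\ge 0$ let $E_{\mathbf{k}}(\{p_i,\rho_i\})=\sum_i p_iE_{\mathbf{k}}(\rho_i)$; an ensemble may also be given by the unnormalized operators $\tilde\rho_i=p_i\rho_i$,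 and then its value is $\sum_iE_{\mathbf{k}}(\tilde\rho_i)$. Members of an ensemble may live on systems of different local dimensions. A finite ensemble of unnormalized states is transformed by LOCC into another one if this is achieved by finitely many steps of the following two kinds. (i) One member $\rho$ is replaced by the members $\mathcal{A}_m(\rho)$, $m=1,\dots,M$, where the $\mathcal{A}_m$ are quantum operations $\mathcal{A}_m(\rho)=\sum_sA_{ms}\rho A_{ms}^\dagger$ (finite sums) that act on the subsystem of one and the same party only, whose output dimension may depend on $m$, and whose sum $\sum_m\mathcal{A}_m$ is trace preserving, $\sum_{m,s}A_{ms}^\dagger A_{ms}=1$; the party and the operations may depend on the member. (ii) Two members $\rho,\sigma$ on the same system are replaced by the one member $\rho+\sigma$ (classical information is forgotten). A state is regarded as an ensemble with one member. **Theorem.** The maxima above exist, and $E_{\mathbf{k}}(|\psi\rangle\langle\psi|)=E_{\mathbf{k}}(\psi)$. Every $E_{\mathbf{k}}$ is an (increasing) entanglement monotone: it cannot decrease under LOCC. That is, if a pure state, a mixed state or an ensemble $S$ is transformed by LOCC into a pure state, a mixed state or an ensemble $T$, and $k_q\le d_q$ for all $q$ on the system of every member of $S$ and of $T$, then $$E_{\mathbf{k}}(S)\le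 E_{\mathbf{k}}(T).$$ -/

import Mathlib

open scoped Matrix NNReal ComplexOrder

/-- Labels of the product basis of `ℂ^{d 1} ⊗ ⋯ ⊗ ℂ^{d N}`. -/
abbrev BasisIdx {N : ℕ} (d : Fin N → ℕ) : Type := (q : Fin N) → Fin (d q)

/-- The Hilbert space `ℂ^{d 1} ⊗ ⋯ ⊗ ℂ^{d N}` of an `N`-partite system, in its product basis. -/
abbrev PureState {N : ℕ} (d : Fin N → ℕ) : Type := EuclideanSpace ℂ (BasisIdx d)

/-- Operators on `ℂ^{d 1} ⊗ ⋯ ⊗ ℂ^{d N}`, as matrices in the product basis. -/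
abbrev Operator {N : ℕ} (d : Fin N → ℕ) : Type := Matrix (BasisIdx d) (BasisIdx d) ℂ

/-- The tensor product `Γ 1 ⊗ ⋯ ⊗ Γ N` of local operators (a Kronecker product). -/
def tensorOp {N : ℕ} {d : Fin N → ℕ} (Γ : (q : Fin N) → Matrix (Fin (d q)) (Fin (d q)) ℂ) :
    Operator d :=
  Matrix.of fun x y => ∏ q, Γ q (x q) (y q)

/-- The (unnormalized) density operator `|ψ⟩⟨ψ|`. -/
def ketBra {N : ℕ} {d : Fin N → ℕ} (ψ : PureState d) : Operator d :=
  Matrix.vecMulVec (fun x => ψ x) (fun x => star (ψ x))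

/-- The numbers `‖(Γ 1 ⊗ ⋯ ⊗ Γ N) ψ‖²`, each `Γ q` an orthogonal projector of rank `k q` on the
space of party `q`. -/
def projectionValues {N : ℕ} (k : Fin N → ℕ) {d : Fin N → ℕ} (ψ : PureState d) : Set ℝ :=
  {r | ∃ Γ : (q : Fin N) → Matrix (Fin (d q)) (Fin (d q)) ℂ,
    (∀ q, IsStarProjection (Γ q) ∧ (Γ q).rank = k q) ∧
    r = ‖Matrix.toEuclideanLin (tensorOp Γ) ψ‖ ^ 2}

/-- `E_k` of a (not necessarily normalized) pure state. -/
noncomputable def pureE {N : ℕ} (k : Fin N → ℕ) {d : Fin N → ℕ} (ψ : PureState d) : ℝ :=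
  sSup (projectionValues k ψ)

/-- The numbers `∑ i, E_k (ψ i)`, over the finite pure-state ensembles with
`∑ i, |ψ i⟩⟨ψ i| = ρ`. -/
def roofValues {N : ℕ} (k : Fin N → ℕ) {d : Fin N → ℕ} (ρ : Operator d) : Set ℝ :=
  {r | ∃ (n : ℕ) (ψ : Fin n → PureState d),
    ∑ i, ketBra (ψ i) = ρ ∧ r = ∑ i, pureE k (ψ i)}

/-- `E_k` of a (not necessarily normalized) mixed state: the concave roof of `pureE k`. -/
noncomputable def mixedE {N : ℕ} (k : Fin N → ℕ) {d : Fin N → ℕ} (ρ : Operator d) : ℝ :=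
  sSup (roofValues k ρ)

/-- An operator on an `N`-partite system, together with the local dimensions of that system. -/
abbrev SystemOp (N : ℕ) : Type := (d : Fin N → ℕ) × Operator d

/-- A finite ensemble of mixed states, represented by unnormalized density operators `ρ` whose
traces are the probabilities. Different members may live on systems of different local dimensions. -/
abbrev Ensemble (N : ℕ) : Type := Multiset (SystemOp N)

/-- The ensemble whose only member is `ρ`. -/
def Ensemble.single {N : ℕ} {d : Fin N → ℕ} (ρ : Operator d) : Ensemble N :=
  {(⟨d, ρ⟩ : SystemOp N)}

/-- All members of the ensemble are positive semidefinite. -/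
def Ensemble.IsPos {N : ℕ} (S : Ensemble N) : Prop := ∀ s ∈ S, s.2.PosSemidef

/-- The ranks `k` do not exceed the local dimensions of any member. -/
def Ensemble.Admits {N : ℕ} (S : Ensemble N) (k : Fin N → ℕ) : Prop := ∀ s ∈ S, ∀ q, k q ≤ s.1 q

/-- `E_k` of an ensemble of unnormalized states: the sum of the values of its members. -/
noncomputable def Ensemble.E {N : ℕ} (k : Fin N → ℕ) (S : Ensemble N) : ℝ :=
  (S.map fun s => mixedE k s.2).sum

/-- A finite ensemble `{p i, ρ i}` with explicit weights. -/
abbrev WeightedEnsemble (N : ℕ) : Type := Multiset (ℝ≥0 × SystemOp N)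

/-- The representation of `{p i, ρ i}` by the unnormalized operators `p i • ρ i`. -/
noncomputable def WeightedEnsemble.toEnsemble {N : ℕ} (S : WeightedEnsemble N) : Ensemble N :=
  S.map fun s => ⟨s.2.1, ((s.1 : ℝ) : ℂ) • s.2.2⟩

/-- `E_k` of an ensemble `{p i, ρ i}`: the average `∑ i, p i * E_k (ρ i)`. -/
noncomputable def WeightedEnsemble.E {N : ℕ} (k : Fin N → ℕ) (S : WeightedEnsemble N) : ℝ :=
  (S.map fun s => (s.1 : ℝ) * mixedE k s.2.2).sum

/-- The operator `1 ⊗ ⋯ ⊗ A ⊗ ⋯ ⊗ 1` in which `A : ℂ^{d p} → ℂ^n` acts on party `p`; it maps the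
system with local dimensions `d` to the one in which the dimension of party `p` has become `n`. -/
def onParty {N : ℕ} {d : Fin N → ℕ} (p : Fin N) {n : ℕ} (A : Matrix (Fin n) (Fin (d p)) ℂ) :
    Matrix (BasisIdx (Function.update d p n)) (BasisIdx d) ℂ :=
  Matrix.of fun x y =>
    if ∀ q, q ≠ p → (x q : ℕ) = (y q : ℕ) then
      A (Fin.cast (Function.update_self p n d) (x p)) (y p)
    else 0

/-- A quantum instrument of one party with input space `ℂ^a`: finitely many quantum operations
`A_m`, one for each outcome `m`, given by Kraus operators `A_{m s}` from `ℂ^a` to the output space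
of outcome `m`, whose sum is trace preserving. -/
structure LocalInstrument (a : ℕ) where
  outcomes : ℕ
  dim : Fin outcomes → ℕ
  krausCount : Fin outcomes → ℕ
  kraus : (m : Fin outcomes) → Fin (krausCount m) → Matrix (Fin (dim m)) (Fin a) ℂ
  complete : ∑ m, ∑ s, (kraus m s)ᴴ * kraus m s = 1

/-- The unnormalized state `∑ s, A_{m s} ρ A_{m s}†` after outcome `m`, when party `p` applies the
instrument to its part of `ρ`. -/
def LocalInstrument.post {N : ℕ} {d : Fin N → ℕ} {p : Fin N} (I : LocalInstrument (d p))
    (ρ : Operator d) (m : Fin I.outcomes) : Operator (Function.update d p (I.dim m)) :=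
  ∑ s, onParty p (I.kraus m s) * ρ * (onParty p (I.kraus m s))ᴴ

/-- The ensemble of all the unnormalized states `LocalInstrument.post`. -/
def LocalInstrument.run {N : ℕ} {d : Fin N → ℕ} {p : Fin N} (I : LocalInstrument (d p))
    (ρ : Operator d) : Ensemble N :=
  (Finset.univ : Finset (Fin I.outcomes)).val.map fun m => ⟨_, I.post ρ m⟩

/-- `LOCC S T`: the ensemble `S` can be transformed with certainty into the ensemble `T` by local
operations and classical communication, that is, by finitely many steps of two kinds. Either some
party measures its own subsystem in one member of the ensemble and announces the outcome to all
parties (the choice of party and instrument may depend on the member, which is what classical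
communication allows), or the parties forget which of two members they hold. -/
inductive LOCC {N : ℕ} : Ensemble N → Ensemble N → Prop
  | refl (S : Ensemble N) : LOCC S S
  | trans {S T U : Ensemble N} : LOCC S T → LOCC T U → LOCC S U
  | operate {d : Fin N → ℕ} (ρ : Operator d) (S : Ensemble N) (p : Fin N)
      (I : LocalInstrument (d p)) : LOCC (Ensemble.single ρ + S) (I.run ρ + S)
  | forget {d : Fin N → ℕ} (ρ σ : Operator d) (S : Ensemble N) :
      LOCC (Ensemble.single ρ + Ensemble.single σ + S) (Ensemble.single (ρ + σ) + S)

/-! An LOCC protocol may pass through systems with local dimensions below `k`, where `pureE k` is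
the supremum of an empty set. Monotonicity is therefore proved step by step for `boundedE`, which
allows ranks at most `k q` and makes sense in all dimensions. When `k q ≤ d q`, projectors can be
enlarged to rank exactly `k q` without loss, so `boundedE` agrees with `mixedE` on positive
operators (`mixedE_eq_boundedE`).

The core is a measurement by one party `p` on a pure state (`exists_proj_sum_frobSq_ge`). With the
other projectors applied, the state is a matrix `X` from the other parties to `p`. If `C` is the
projector of `p`, then `C * X` has rank at most `C.rank`, so its row space has a projector `P` of no
larger rank with `C * X * P = C * X`. This transfers the rank constraint to the side that the
measurement does not touch: `X * P` retains at least as much norm as `C * X`, the operators `A i`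
preserve its total squared norm, and each `A i * X * P` again has small rank, so projecting onto its
range moves the constraint back to party `p`.

Mixed states follow by applying this to each member of a decomposition (`boundedE_le_sum_post`);
forgetting is superadditivity of the roof (`boundedE_add_le`). The roof is attained because its
values form a slice of the convex hull of a compact set. -/

theorem Submodule.exists_le_finrank_eq {K V : Type*} [DivisionRing K] [AddCommGroup V] [Module K V]
    [FiniteDimensional K V] (U : Submodule K V) {r : ℕ} (hU : Module.finrank K U ≤ r)
    (hr : r ≤ Module.finrank K V) : ∃ W : Submodule K V, U ≤ W ∧ Module.finrank K W = r := by
  induction r, hU using Nat.le_induction with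
  | base => exact ⟨U, le_rfl, rfl⟩
  | succ r _ ih =>
    obtain ⟨W, hUW, hW⟩ := ih (by omega)
    obtain ⟨x, hx⟩ : ∃ x, x ∉ W := by
      by_contra! h
      rw [(Submodule.eq_top_iff'.2 h), finrank_top] at hW
      omega
    refine ⟨W ⊔ Submodule.span K {x}, hUW.trans le_sup_left, ?_⟩
    have hx0 : x ≠ 0 := fun h => hx (h ▸ W.zero_mem)
    have hd : W ⊓ Submodule.span K {x} = ⊥ :=
      disjoint_iff.1 ((Submodule.disjoint_span_singleton' hx0).2 hx)
    have := Submodule.finrank_sup_add_finrank_inf_eq W (Submodule.span K {x})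
    rw [hd, finrank_bot, finrank_span_singleton hx0, hW] at this
    simpa using this

/-! ### Frobenius norms, orthogonal projectors, and measurement of one tensor factor. -/

namespace Matrix

variable {m n : Type*} [Fintype m] [Fintype n]

/-- The squared Frobenius norm. -/
noncomputable def frobSq (X : Matrix m n ℂ) : ℝ := ∑ i, ∑ j, ‖X i j‖ ^ 2

theorem frobSq_nonneg (X : Matrix m n ℂ) : 0 ≤ frobSq X := by
  unfold frobSq; positivity

theorem frobSq_eq_trace (X : Matrix m n ℂ) : (frobSq X : ℂ) = trace (Xᴴ * X) := by
  simp only [frobSq, trace, diag, mul_apply, conjTranspose_apply, Complex.ofReal_sum]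
  rw [Finset.sum_comm]
  refine Finset.sum_congr rfl fun i _ => Finset.sum_congr rfl fun j _ => ?_
  rw [Complex.star_def, Complex.conj_mul', Complex.ofReal_pow]

theorem frobSq_conjTranspose (X : Matrix m n ℂ) : frobSq Xᴴ = frobSq X := by
  simp only [frobSq, conjTranspose_apply, norm_star]
  exact Finset.sum_comm

theorem frobSq_proj_mul_add [DecidableEq m] {P : Matrix m m ℂ} (hP : IsStarProjection P)
    (X : Matrix m n ℂ) : frobSq (P * X) + frobSq ((1 - P) * X) = frobSq X := by
  have h (Q : Matrix m m ℂ) (hQ : IsStarProjection Q) :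
      (frobSq (Q * X) : ℂ) = trace (Xᴴ * (Q * X)) := by
    rw [frobSq_eq_trace, conjTranspose_mul, ← star_eq_conjTranspose Q, hQ.isSelfAdjoint.star_eq,
      Matrix.mul_assoc, ← Matrix.mul_assoc Q Q, hQ.isIdempotentElem.eq]
  apply Complex.ofReal_injective
  rw [Complex.ofReal_add, h _ hP, h _ hP.one_sub, frobSq_eq_trace, ← trace_add, ← Matrix.mul_add,
    ← Matrix.add_mul, add_sub_cancel, Matrix.one_mul]

theorem frobSq_proj_mul_le {P : Matrix m m ℂ} (hP : IsStarProjection P)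
    (X : Matrix m n ℂ) : frobSq (P * X) ≤ frobSq X := by
  classical
  linarith [frobSq_proj_mul_add hP X, frobSq_nonneg ((1 - P) * X)]

theorem frobSq_mul_proj_le {P : Matrix n n ℂ} (hP : IsStarProjection P)
    (X : Matrix m n ℂ) : frobSq (X * P) ≤ frobSq X := by
  have := frobSq_proj_mul_le hP Xᴴ
  rwa [← frobSq_conjTranspose, conjTranspose_mul, conjTranspose_conjTranspose,
    ← star_eq_conjTranspose P, hP.isSelfAdjoint.star_eq, frobSq_conjTranspose] at this

theorem sum_frobSq_mul {ι : Type*} [Fintype ι] {r : ι → Type*} [∀ i, Fintype (r i)]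
    [DecidableEq m] {A : (i : ι) → Matrix (r i) m ℂ} (hA : ∑ i, (A i)ᴴ * A i = 1)
    (X : Matrix m n ℂ) : ∑ i, frobSq (A i * X) = frobSq X := by
  apply Complex.ofReal_injective
  simp only [Complex.ofReal_sum, frobSq_eq_trace, conjTranspose_mul]
  rw [← trace_sum]
  congr 1
  calc ∑ i, Xᴴ * (A i)ᴴ * (A i * X) = Xᴴ * (∑ i, (A i)ᴴ * A i) * X := by
        simp only [Matrix.mul_sum, Matrix.sum_mul, Matrix.mul_assoc]
    _ = _ := by rw [hA, Matrix.mul_one]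

theorem rank_eq_finrank_range_toEuclideanLin [DecidableEq n] (A : Matrix m n ℂ) :
    A.rank = Module.finrank ℂ (LinearMap.range (toEuclideanLin A)) := by
  rw [toEuclideanLin, toLpLin_eq_toLin, ← rank_eq_finrank_range_toLin]

/-- The matrix of the orthogonal projector onto a subspace. -/
noncomputable def projMatrix [DecidableEq m] (U : Submodule ℂ (EuclideanSpace ℂ m)) :
    Matrix m m ℂ :=
  (toEuclideanCLM (n := m) (𝕜 := ℂ)).symm U.starProjection

section
variable [DecidableEq m] (U : Submodule ℂ (EuclideanSpace ℂ m))

theorem toEuclideanLin_projMatrix (x : EuclideanSpace ℂ m) :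
    toEuclideanLin (projMatrix U) x = U.starProjection x := by
  rw [← coe_toEuclideanCLM_eq_toEuclideanLin, projMatrix]
  simp

theorem isStarProjection_projMatrix : IsStarProjection (projMatrix U) :=
  have h := isStarProjection_starProjection (U := U)
  ⟨by rw [IsIdempotentElem, projMatrix, ← map_mul, h.isIdempotentElem.eq],
    ((toEuclideanCLM (n := m) (𝕜 := ℂ)).symm.map_star' _).symm.trans
      (congrArg _ h.isSelfAdjoint.star_eq)⟩

theorem rank_projMatrix : (projMatrix U).rank = Module.finrank ℂ U := by
  rw [rank_eq_finrank_range_toEuclideanLin]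
  suffices LinearMap.range (toEuclideanLin (projMatrix U)) = U by rw [this]
  ext x
  constructor
  · rintro ⟨y, rfl⟩
    rw [toEuclideanLin_projMatrix]
    exact Submodule.starProjection_apply_mem _ _
  · intro hx
    exact ⟨x, by rw [toEuclideanLin_projMatrix, Submodule.starProjection_eq_self_iff.2 hx]⟩

theorem projMatrix_mul [DecidableEq n] {X : Matrix m n ℂ}
    (h : LinearMap.range (toEuclideanLin X) ≤ U) : projMatrix U * X = X := by
  apply (toEuclideanLin (𝕜 := ℂ)).injective
  ext1 x
  have : toEuclideanLin (projMatrix U * X) x =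
      toEuclideanLin (projMatrix U) (toEuclideanLin X x) := by
    simp [toLpLin_apply]
  rw [this, toEuclideanLin_projMatrix]
  exact Submodule.starProjection_eq_self_iff.2 (h ⟨x, rfl⟩)

end

theorem exists_proj_mul_eq_self (X : Matrix m n ℂ) :
    ∃ P : Matrix m m ℂ, IsStarProjection P ∧ P.rank = X.rank ∧ P * X = X := by
  classical
  exact ⟨projMatrix _, isStarProjection_projMatrix _,
    (rank_projMatrix _).trans (rank_eq_finrank_range_toEuclideanLin X).symm,
    projMatrix_mul _ le_rfl⟩

/-- Any subspace of dimension at least that of the range of `P`, and containing it, gives such a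
`Q`; this is what lets "rank at most `r`" be replaced by "rank `r`". -/
theorem exists_proj_rank_eq {P : Matrix m m ℂ} (hP : IsStarProjection P) {r : ℕ}
    (hr : P.rank ≤ r) (hrm : r ≤ Fintype.card m) :
    ∃ Q : Matrix m m ℂ, IsStarProjection Q ∧ Q.rank = r ∧ P * Q = P := by
  classical
  rw [rank_eq_finrank_range_toEuclideanLin] at hr
  obtain ⟨W, hPW, hW⟩ := Submodule.exists_le_finrank_eq _ hr (by simpa using hrm)
  refine ⟨projMatrix W, isStarProjection_projMatrix _, (rank_projMatrix _).trans hW, ?_⟩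
  have := congrArg star (projMatrix_mul W hPW)
  rwa [star_mul, hP.isSelfAdjoint.star_eq, (isStarProjection_projMatrix W).isSelfAdjoint.star_eq]
    at this

/-- A quantum measurement does not decrease, on average, the largest squared Frobenius norm
which a projector of rank at most `r` can retain. -/
theorem exists_proj_sum_frobSq_ge {ι : Type*} [Fintype ι] {b : ι → Type*} [∀ i, Fintype (b i)]
    [DecidableEq m] {A : (i : ι) → Matrix (b i) m ℂ} (hA : ∑ i, (A i)ᴴ * A i = 1)
    {C : Matrix m m ℂ} (hC : IsStarProjection C) (X : Matrix m n ℂ) :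
    ∃ Q : (i : ι) → Matrix (b i) (b i) ℂ,
      (∀ i, IsStarProjection (Q i) ∧ (Q i).rank ≤ C.rank) ∧
      frobSq (C * X) ≤ ∑ i, frobSq (Q i * (A i * X)) := by
  -- The adjoint is used so that `P` projects on the index set `n`, on which the `A i` do not act.
  obtain ⟨P, hP, hPr, hPX⟩ := exists_proj_mul_eq_self (C * X)ᴴ
  choose Q hQ hQr hQX using fun i => exists_proj_mul_eq_self (A i * X * P)
  refine ⟨Q, fun i => ⟨hQ i, ?_⟩, ?_⟩
  · calc (Q i).rank ≤ P.rank := (hQr i).trans_le (rank_mul_le_right _ _)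
      _ ≤ C.rank := by
        rw [hPr, rank_conjTranspose]
        exact rank_mul_le_left _ _
  · have hXP : C * X * P = C * X := by
      have := congrArg conjTranspose hPX
      rwa [conjTranspose_mul, conjTranspose_conjTranspose, ← star_eq_conjTranspose P,
        hP.isSelfAdjoint.star_eq] at this
    calc frobSq (C * X) = frobSq (C * (X * P)) := by rw [← Matrix.mul_assoc, hXP]
      _ ≤ frobSq (X * P) := frobSq_proj_mul_le hC _
      _ = ∑ i, frobSq (A i * (X * P)) := (sum_frobSq_mul hA _).symm
      _ ≤ _ := Finset.sum_le_sum fun i _ => by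
        rw [← Matrix.mul_assoc (A i), ← hQX i, ← Matrix.mul_assoc (Q i)]
        exact frobSq_mul_proj_le hP _

theorem trace_eq_rank {P : Matrix m m ℂ} (hP : IsStarProjection P) : P.trace = P.rank := by
  classical
  have hI : IsIdempotentElem (toEuclideanLin P) := by
    ext1 x
    simp [toLpLin_apply, hP.isIdempotentElem.eq]
  have := (LinearMap.isProj_range_iff_isIdempotentElem _ |>.2 hI).trace
  rwa [← rank_eq_finrank_range_toEuclideanLin, toEuclideanLin, toLpLin_eq_toLin,
    trace_toLin_eq] at this

theorem norm_apply_sq_le_rank {P : Matrix m m ℂ} (hP : IsStarProjection P) (i j : m) :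
    ‖P i j‖ ^ 2 ≤ P.rank := by
  have h : frobSq P = P.rank := by
    apply Complex.ofReal_injective
    rw [frobSq_eq_trace, ← star_eq_conjTranspose, hP.isSelfAdjoint.star_eq,
      hP.isIdempotentElem.eq, trace_eq_rank hP, Complex.ofReal_natCast]
  rw [← h, frobSq]
  exact (Finset.single_le_sum (f := fun j => ‖P i j‖ ^ 2) (fun _ _ => by positivity)
    (Finset.mem_univ j)).trans (Finset.single_le_sum (f := fun i => ∑ j, ‖P i j‖ ^ 2)
    (fun _ _ => by positivity) (Finset.mem_univ i))

/-- The rank of a projector is its trace, so the rank condition is closed although rank itself is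
not continuous. Boundedness holds because the squared Frobenius norm of a projector is also its
rank. -/
theorem isCompact_setOf_isStarProjection (s : Finset ℕ) :
    IsCompact {P : Matrix m m ℂ | IsStarProjection P ∧ P.rank ∈ s} := by
  have hset : {P : Matrix m m ℂ | IsStarProjection P ∧ P.rank ∈ s} =
      {P | P * P = P} ∩ {P | star P = P} ∩ {P | P.trace ∈ (fun r : ℕ => (r : ℂ)) '' s} := by
    ext P
    constructor
    · rintro ⟨hP, hs⟩
      exact ⟨⟨hP.isIdempotentElem, hP.isSelfAdjoint⟩, P.rank, hs, (trace_eq_rank hP).symm⟩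
    · rintro ⟨⟨h1, h2⟩, r, hr, h3⟩
      have hP : IsStarProjection P := ⟨h1, h2⟩
      rw [trace_eq_rank hP] at h3
      exact ⟨hP, by rw [← Nat.cast_injective h3]; exact hr⟩
  have hclosed : IsClosed {P : Matrix m m ℂ | IsStarProjection P ∧ P.rank ∈ s} := by
    rw [hset]
    refine ((isClosed_eq (by fun_prop) continuous_id).inter
      (isClosed_eq (by fun_prop) continuous_id)).inter ?_
    exact (s.finite_toSet.image _).isClosed.preimage (Continuous.matrix_trace continuous_id)
  have hK : IsCompact (Set.univ.pi fun _ : m => Set.univ.pi fun _ : m =>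
      Metric.closedBall (0 : ℂ) (Fintype.card m + 1)) :=
    isCompact_univ_pi fun _ => isCompact_univ_pi fun _ => isCompact_closedBall _ _
  refine hK.of_isClosed_subset hclosed ?_
  rintro P ⟨hP, _⟩ i _ j _
  rw [mem_closedBall_zero_iff]
  have h1 := norm_apply_sq_le_rank hP i j
  have h2 : (rank P : ℝ) ≤ Fintype.card m := by exact_mod_cast rank_le_card_width P
  nlinarith [norm_nonneg (P i j)]

end Matrix

theorem IsStarProjection.submatrix_equiv {m n : Type*} [Fintype m] [Fintype n]
    {P : Matrix n n ℂ} (hP : IsStarProjection P) (f : m ≃ n) :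
    IsStarProjection (P.submatrix f f) :=
  ⟨by rw [IsIdempotentElem, Matrix.submatrix_mul_equiv, hP.isIdempotentElem.eq],
    by rw [IsSelfAdjoint, Matrix.star_eq_conjTranspose, Matrix.conjTranspose_submatrix,
      ← Matrix.star_eq_conjTranspose, hP.isSelfAdjoint.star_eq]⟩

/-! ### Tensor products of local projectors. -/

section TensorOp

variable {N : ℕ} {d : Fin N → ℕ}

theorem tensorOp_mul (A B : (q : Fin N) → Matrix (Fin (d q)) (Fin (d q)) ℂ) :
    tensorOp A * tensorOp B = tensorOp fun q => A q * B q := by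
  ext x y
  simp only [tensorOp, Matrix.mul_apply, Matrix.of_apply, Finset.prod_univ_sum,
    Fintype.piFinset_univ, Finset.prod_mul_distrib]

theorem star_tensorOp (A : (q : Fin N) → Matrix (Fin (d q)) (Fin (d q)) ℂ) :
    star (tensorOp A) = tensorOp fun q => star (A q) := by
  ext x y
  simp [tensorOp, Matrix.star_apply]

theorem isStarProjection_tensorOp {Γ : (q : Fin N) → Matrix (Fin (d q)) (Fin (d q)) ℂ}
    (hΓ : ∀ q, IsStarProjection (Γ q)) : IsStarProjection (tensorOp Γ) :=
  ⟨by simp_rw [IsIdempotentElem, tensorOp_mul, fun q => (hΓ q).isIdempotentElem.eq],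
    by simp_rw [IsSelfAdjoint, star_tensorOp, fun q => (hΓ q).isSelfAdjoint.star_eq]⟩

theorem norm_toEuclideanLin_proj_le {n : Type*} [Fintype n] [DecidableEq n] {P : Matrix n n ℂ}
    (hP : IsStarProjection P) (φ : EuclideanSpace ℂ n) :
    ‖Matrix.toEuclideanLin P φ‖ ^ 2 ≤ ‖φ‖ ^ 2 := by
  have h (χ : EuclideanSpace ℂ n) :
      ‖χ‖ ^ 2 = Matrix.frobSq (Matrix.of fun x (_ : Unit) => χ x) := by
    simp [EuclideanSpace.norm_sq_eq, Matrix.frobSq]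
  rw [h, h]
  refine le_trans (le_of_eq ?_) (Matrix.frobSq_proj_mul_le hP _)
  congr 1

theorem norm_tensorOp_le_of_mul_eq {Γ Δ : (q : Fin N) → Matrix (Fin (d q)) (Fin (d q)) ℂ}
    (hΓ : ∀ q, IsStarProjection (Γ q)) (h : ∀ q, Γ q * Δ q = Γ q) (ψ : PureState d) :
    ‖Matrix.toEuclideanLin (tensorOp Γ) ψ‖ ^ 2 ≤ ‖Matrix.toEuclideanLin (tensorOp Δ) ψ‖ ^ 2 := by
  have hm : tensorOp Γ = tensorOp Γ * tensorOp Δ := by simp_rw [tensorOp_mul, h]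
  have : Matrix.toEuclideanLin (tensorOp Γ) ψ =
      Matrix.toEuclideanLin (tensorOp Γ) (Matrix.toEuclideanLin (tensorOp Δ) ψ) := by
    conv_lhs => rw [hm]
    simp [Matrix.toLpLin_apply]
  rw [this]
  exact norm_toEuclideanLin_proj_le (isStarProjection_tensorOp hΓ) _

end TensorOp

/-! ### Pure states as matrices between one party and the rest. -/

section Slice

variable {N : ℕ} {d e : Fin N → ℕ} {p : Fin N} {n : ℕ}

/-- Labels of the product basis of all parties other than `p`. -/
abbrev RestIdx (d : Fin N → ℕ) (p : Fin N) : Type := (j : {j // j ≠ p}) → Fin (d j)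

/-- Separation of party `p` from the others, for a system which agrees with `d` off `p`. -/
def partyEquiv (hp : e p = n) (h : ∀ q, q ≠ p → e q = d q) :
    BasisIdx e ≃ RestIdx d p × Fin n :=
  (Equiv.piSplitAt p fun q => Fin (e q)).trans <| (Equiv.prodComm _ _).trans <|
    Equiv.prodCongr (Equiv.piCongrRight fun j => finCongr (h j j.2)) (finCongr hp)

theorem partyEquiv_fst (hp : e p = n) (h : ∀ q, q ≠ p → e q = d q) (x : BasisIdx e)
    (j : {j // j ≠ p}) : (partyEquiv hp h x).1 j = Fin.cast (h j j.2) (x j) := rfl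

/-- A pure state as a matrix from the space of the other parties to that of party `p`. -/
def slice (hp : e p = n) (h : ∀ q, q ≠ p → e q = d q) (ψ : PureState e) :
    Matrix (Fin n) (RestIdx d p) ℂ :=
  Matrix.of fun a r => ψ ((partyEquiv hp h).symm (r, a))

/-- A pure state of the system `d` as a matrix from the space of the other parties to that of
party `p`. -/
abbrev partySlice (p : Fin N) (ψ : PureState d) : Matrix (Fin (d p)) (RestIdx d p) ℂ :=
  slice rfl (fun _ _ => rfl) ψ

theorem norm_sq_eq_frobSq_slice (hp : e p = n) (h : ∀ q, q ≠ p → e q = d q) (ψ : PureState e) :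
    ‖ψ‖ ^ 2 = Matrix.frobSq (slice hp h ψ) := by
  rw [EuclideanSpace.norm_sq_eq, Matrix.frobSq, Finset.sum_comm,
    ← (partyEquiv hp h).symm.sum_comp, Fintype.sum_prod_type]
  rfl

/-- The tensor product of the local operators of all parties other than `p`. -/
def restOp (p : Fin N) (Γ : (q : Fin N) → Matrix (Fin (d q)) (Fin (d q)) ℂ) :
    Matrix (RestIdx d p) (RestIdx d p) ℂ :=
  Matrix.of fun x y => ∏ j : {j // j ≠ p}, Γ j (x j) (y j)

/-- Party `p` acts from the left and all others from the right. The system `e` may differ from `d`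
at `p`, so that states before and after a measurement have slices with the same column index type
`RestIdx d p`. -/
theorem slice_tensorOp (hp : e p = n) (h : ∀ q, q ≠ p → e q = d q)
    {Γ : (q : Fin N) → Matrix (Fin (d q)) (Fin (d q)) ℂ}
    {Δ : (q : Fin N) → Matrix (Fin (e q)) (Fin (e q)) ℂ} {Q : Matrix (Fin n) (Fin n) ℂ}
    (hΔp : Δ p = Q.submatrix (finCongr hp) (finCongr hp))
    (hΔ : ∀ q (hq : q ≠ p), Δ q = (Γ q).submatrix (finCongr (h q hq)) (finCongr (h q hq)))
    (ψ : PureState e) :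
    slice hp h (Matrix.toEuclideanLin (tensorOp Δ) ψ) =
      Q * (slice hp h ψ * (restOp p Γ)ᵀ) := by
  have key (x y : BasisIdx e) : tensorOp Δ x y =
      restOp p Γ (partyEquiv hp h x).1 (partyEquiv hp h y).1 *
        Q (partyEquiv hp h x).2 (partyEquiv hp h y).2 := by
    simp only [tensorOp, restOp, Matrix.of_apply]
    rw [Fintype.prod_eq_mul_prod_subtype_ne _ p, mul_comm, hΔp]
    congr 1
    refine Finset.prod_congr rfl fun j _ => ?_
    rw [hΔ j j.2]
    rfl
  ext a r
  simp only [slice, Matrix.of_apply, Matrix.toLpLin_apply, Matrix.mulVec, dotProduct,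
    Matrix.mul_apply, Matrix.transpose_apply]
  rw [← (partyEquiv hp h).symm.sum_comp, Fintype.sum_prod_type, Finset.sum_comm]
  simp only [key, Equiv.apply_symm_apply, Finset.mul_sum]
  exact Finset.sum_congr rfl fun b _ => Finset.sum_congr rfl fun s _ => by ring

theorem slice_onParty (A : Matrix (Fin n) (Fin (d p)) ℂ) (ψ : PureState d) :
    slice (Function.update_self p n d) (fun _ hq => Function.update_of_ne hq n d)
      (Matrix.toEuclideanLin (onParty p A) ψ) = A * partySlice p ψ := by
  set hp := Function.update_self p n d
  set h : ∀ q, q ≠ p → Function.update d p n q = d q := fun _ hq => Function.update_of_ne hq n d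
  have key (x : BasisIdx (Function.update d p n)) (y : BasisIdx d) : onParty p A x y =
      if (partyEquiv hp h x).1 = (partyEquiv (d := d) (p := p) rfl (fun _ _ => rfl) y).1 then
        A (partyEquiv hp h x).2 (partyEquiv (d := d) (p := p) rfl (fun _ _ => rfl) y).2
      else 0 := by
    simp only [onParty, Matrix.of_apply]
    refine if_congr ?_ rfl rfl
    rw [funext_iff]
    simp only [partyEquiv_fst, Fin.ext_iff, Subtype.forall]
    rfl
  ext a r
  rw [Matrix.mul_apply]
  simp only [slice, Matrix.of_apply, Matrix.toLpLin_apply, Matrix.mulVec, dotProduct]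
  rw [← (partyEquiv (d := d) (p := p) rfl (fun _ _ => rfl)).symm.sum_comp,
    Fintype.sum_prod_type, Finset.sum_comm]
  refine Finset.sum_congr rfl fun b _ => ?_
  simp only [key, Equiv.apply_symm_apply, ite_mul, zero_mul]
  rw [Finset.sum_ite_eq]
  simp

end Slice

/-! ### Local measurements on pure states. -/

/-- The families of local orthogonal projectors whose ranks belong to given sets. -/
def localProjectors {N : ℕ} (s : Fin N → Finset ℕ) (d : Fin N → ℕ) :
    Set ((q : Fin N) → Matrix (Fin (d q)) (Fin (d q)) ℂ) :=
  {Γ | ∀ q, IsStarProjection (Γ q) ∧ (Γ q).rank ∈ s q}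

theorem isCompact_localProjectors {N : ℕ} (s : Fin N → Finset ℕ) (d : Fin N → ℕ) :
    IsCompact (localProjectors s d) := by
  have : localProjectors s d = Set.univ.pi fun q =>
      {P : Matrix (Fin (d q)) (Fin (d q)) ℂ | IsStarProjection P ∧ P.rank ∈ s q} := by
    ext Γ
    simp [localProjectors]
  rw [this]
  exact isCompact_univ_pi fun q => Matrix.isCompact_setOf_isStarProjection _

/-- A local measurement does not decrease, on average, what local projectors of bounded rank
can retain of a pure state. -/
theorem exists_localProjectors_sum_ge {N : ℕ} {k d : Fin N → ℕ} {p : Fin N} {ι : Type*}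
    [Fintype ι] {b : ι → ℕ} {A : (i : ι) → Matrix (Fin (b i)) (Fin (d p)) ℂ}
    (hA : ∑ i, (A i)ᴴ * A i = 1) (ψ : PureState d)
    {Γ : (q : Fin N) → Matrix (Fin (d q)) (Fin (d q)) ℂ}
    (hΓ : Γ ∈ localProjectors (fun q => Finset.Iic (k q)) d) :
    ∃ Δ : (i : ι) → (q : Fin N) → Matrix (Fin (Function.update d p (b i) q))
        (Fin (Function.update d p (b i) q)) ℂ,
      (∀ i, Δ i ∈ localProjectors (fun q => Finset.Iic (k q)) (Function.update d p (b i))) ∧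
      ‖Matrix.toEuclideanLin (tensorOp Γ) ψ‖ ^ 2 ≤
        ∑ i, ‖Matrix.toEuclideanLin (tensorOp (Δ i))
          (Matrix.toEuclideanLin (onParty p (A i)) ψ)‖ ^ 2 := by
  -- The projectors of the other parties are absorbed into the matrix to be measured; they commute
  -- with the action of `p`.
  obtain ⟨Q, hQ, hle⟩ := Matrix.exists_proj_sum_frobSq_ge hA (hΓ p).1
    (partySlice p ψ * (restOp p Γ)ᵀ)
  have hp (i : ι) : Function.update d p (b i) p = b i := Function.update_self p (b i) d
  have h (i : ι) (q : Fin N) (hq : q ≠ p) : Function.update d p (b i) q = d q :=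
    Function.update_of_ne hq (b i) d
  -- Only party `p` changes its projector with the outcome; the others keep theirs, transported
  -- along the equality of dimensions.
  refine ⟨fun i q => if hq : q = p then
      (Q i).submatrix (finCongr (hq ▸ hp i)) (finCongr (hq ▸ hp i))
    else (Γ q).submatrix (finCongr (h i q hq)) (finCongr (h i q hq)), fun i q => ?_, ?_⟩
  · dsimp only
    split_ifs with hq
    · refine ⟨(hQ i).1.submatrix_equiv _, ?_⟩
      subst hq
      rw [Matrix.rank_submatrix]
      exact Finset.mem_Iic.2 ((hQ i).2.trans (Finset.mem_Iic.1 (hΓ q).2))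
    · refine ⟨(hΓ q).1.submatrix_equiv _, ?_⟩
      rw [Matrix.rank_submatrix]
      exact (hΓ q).2
  · rw [norm_sq_eq_frobSq_slice (p := p) rfl (fun _ _ => rfl),
      slice_tensorOp (p := p) rfl (fun _ _ => rfl) (Γ := Γ) (Δ := Γ) (Q := Γ p) rfl
        (fun _ _ => rfl)]
    refine hle.trans (le_of_eq (Finset.sum_congr rfl fun i _ => ?_))
    rw [norm_sq_eq_frobSq_slice (hp i) (h i),
      slice_tensorOp (hp i) (h i) (Γ := Γ) (Q := Q i) (by simp) (fun q hq => by simp [hq]),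
      slice_onParty, Matrix.mul_assoc]

/-! ### Convex hulls of compact sets. -/

/-- By Carathéodory, `finrank ℝ E + 1` points suffice, so the hull is a continuous image of a
simplex times a power of `s`. Shorter combinations are padded with weight `0` at the point `x₀`. -/
theorem IsCompact.convexHull_of_finiteDimensional {E : Type*} [AddCommGroup E] [Module ℝ E]
    [TopologicalSpace E] [ContinuousAdd E] [ContinuousSMul ℝ E] [FiniteDimensional ℝ E]
    {s : Set E} (hs : IsCompact s) : IsCompact (convexHull ℝ s) := by
  obtain rfl | ⟨x₀, hx₀⟩ := s.eq_empty_or_nonempty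
  · simp
  set N := Module.finrank ℝ E + 1
  have hK : IsCompact (stdSimplex ℝ (Fin N) ×ˢ Set.univ.pi fun _ : Fin N => s) :=
    (isCompact_stdSimplex ℝ _).prod (isCompact_univ_pi fun _ => hs)
  convert hK.image (f := fun z => ∑ i, z.1 i • z.2 i) (by fun_prop) using 1
  ext x
  constructor
  · intro hx
    obtain ⟨ι, _, z, w, hz, hind, hw, hw1, hx⟩ := eq_pos_convex_span_of_mem_convexHull hx
    have hcard : Fintype.card ι ≤ Fintype.card (Fin N) := by
      rw [Fintype.card_fin]
      exact hind.card_le_finrank_succ.trans (Nat.succ_le_succ (Submodule.finrank_le _))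
    obtain ⟨f⟩ := Function.Embedding.nonempty_of_card_le hcard
    have hext (j : ι) : Function.extend f w 0 (f j) = w j := f.injective.extend_apply _ _ _
    have hext' (i) (hi : i ∉ Set.range f) : Function.extend f w 0 i = 0 := by
      rw [Function.extend_apply' _ _ _ hi, Pi.zero_apply]
    refine ⟨(Function.extend f w 0, Function.extend f z fun _ => x₀),
      ⟨⟨fun i => ?_, ?_⟩, fun i _ => ?_⟩, ?_⟩ <;> dsimp only
    · by_cases hi : i ∈ Set.range f
      · obtain ⟨j, rfl⟩ := hi
        exact (hw j).le.trans_eq (hext j).symm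
      · exact (hext' i hi).ge
    · rw [← hw1]
      exact (Fintype.sum_of_injective f f.injective _ _ hext' fun j => (hext j).symm).symm
    · by_cases hi : i ∈ Set.range f
      · obtain ⟨j, rfl⟩ := hi
        rw [f.injective.extend_apply]
        exact hz ⟨j, rfl⟩
      · rw [Function.extend_apply' _ _ _ hi]
        exact hx₀
    · rw [← hx]
      refine (Fintype.sum_of_injective f f.injective _ _ (fun i hi => ?_) fun j => ?_).symm
      · rw [hext' i hi, zero_smul]
      · rw [hext, f.injective.extend_apply]
  · rintro ⟨⟨w, z⟩, ⟨hw, hz⟩, rfl⟩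
    exact mem_convexHull_of_exists_fintype w z hw.1 hw.2 (fun i => hz i trivial) rfl

/-! ### Rank-one operators and pure-state decompositions. -/

section KetBra

variable {N : ℕ} {d : Fin N → ℕ}

theorem ketBra_smul (c : ℂ) (ψ : PureState d) : ketBra (c • ψ) = ((‖c‖ ^ 2 : ℝ) : ℂ) • ketBra ψ := by
  ext x y
  simp only [ketBra, Matrix.vecMulVec_apply, PiLp.smul_apply, smul_eq_mul, star_mul',
    Matrix.smul_apply, Complex.ofReal_pow]
  rw [← Complex.mul_conj', ← Complex.star_def]
  ring

theorem ketBra_real_smul (c : ℝ) (ψ : PureState d) : ketBra (c • ψ) = c ^ 2 • ketBra ψ := by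
  rw [← Complex.coe_smul c ψ, ketBra_smul, Complex.coe_smul]
  simp

theorem trace_ketBra (ψ : PureState d) : (ketBra ψ).trace = ((‖ψ‖ ^ 2 : ℝ) : ℂ) := by
  rw [EuclideanSpace.norm_sq_eq, Complex.ofReal_sum]
  refine Finset.sum_congr rfl fun x _ => ?_
  rw [Matrix.diag_apply, ketBra, Matrix.vecMulVec_apply, Complex.star_def, Complex.mul_conj',
    Complex.ofReal_pow]

theorem posSemidef_ketBra (ψ : PureState d) : (ketBra ψ).PosSemidef :=
  Matrix.posSemidef_vecMulVec_self_star _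

theorem continuous_ketBra : Continuous (ketBra : PureState d → Operator d) := by
  unfold ketBra
  exact Continuous.matrix_vecMulVec (by fun_prop) (by fun_prop)

theorem mul_ketBra_mul_conjTranspose {e : Fin N → ℕ} (A : Matrix (BasisIdx e) (BasisIdx d) ℂ)
    (ψ : PureState d) : A * ketBra ψ * Aᴴ = ketBra (Matrix.toEuclideanLin A ψ) := by
  rw [ketBra, Matrix.mul_vecMulVec, Matrix.vecMulVec_mul]
  congr 1
  exact (Matrix.star_mulVec A _).symm

theorem Matrix.PosSemidef.exists_sum_ketBra {ρ : Operator d} (hρ : ρ.PosSemidef) :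
    ∃ (n : ℕ) (ψ : Fin n → PureState d), ∑ i, ketBra (ψ i) = ρ := by
  obtain ⟨n, v, rfl⟩ := Matrix.posSemidef_iff_eq_sum_vecMulVec.1 hρ
  exact ⟨n, fun i => WithLp.toLp 2 (v i), rfl⟩

theorem re_trace_eq_sum {ι : Type*} [Fintype ι] {ψ : ι → PureState d} {ρ : Operator d}
    (h : ∑ i, ketBra (ψ i) = ρ) : ρ.trace.re = ∑ i, ‖ψ i‖ ^ 2 := by
  rw [← h, Matrix.trace_sum, Complex.re_sum]
  exact Finset.sum_congr rfl fun i _ => by rw [trace_ketBra, Complex.ofReal_re]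

theorem inner_ketBra (φ ψ : PureState d) :
    star φ.ofLp ⬝ᵥ (ketBra ψ *ᵥ φ.ofLp) = ((‖inner ℂ ψ φ‖ ^ 2 : ℝ) : ℂ) := by
  have h (a b : PureState d) : inner ℂ a b = star a.ofLp ⬝ᵥ b.ofLp := by
    rw [EuclideanSpace.inner_eq_star_dotProduct, dotProduct_comm]
  rw [ketBra, Matrix.vecMulVec_mulVec, dotProduct_smul, Complex.ofReal_pow, ← Complex.mul_conj',
    inner_conj_symm, h, h, mul_comm]
  rfl

/-- The members of a pure-state ensemble of `|ψ⟩⟨ψ|` are multiples of `ψ`. -/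
theorem exists_smul_of_sum_ketBra_eq {ι : Type*} [Fintype ι] {χ : ι → PureState d}
    {ψ : PureState d} (h : ∑ i, ketBra (χ i) = ketBra ψ) (i : ι) : ∃ c : ℂ, χ i = c • ψ := by
  -- For `φ` orthogonal to `ψ`, evaluating the decomposition at `φ` gives a vanishing sum of the
  -- terms `‖⟪χ i, φ⟫‖²`, so each is zero.
  suffices χ i ∈ (ℂ ∙ ψ)ᗮᗮ by
    rw [Submodule.orthogonal_orthogonal] at this
    obtain ⟨c, hc⟩ := Submodule.mem_span_singleton.1 this
    exact ⟨c, hc.symm⟩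
  rw [Submodule.mem_orthogonal']
  intro φ hφ
  rw [Submodule.mem_orthogonal_singleton_iff_inner_right] at hφ
  have hsum : ∑ i, ‖inner ℂ (χ i) φ‖ ^ 2 = 0 := by
    apply Complex.ofReal_injective
    simp only [Complex.ofReal_sum, ← inner_ketBra]
    rw [← dotProduct_sum, ← Matrix.sum_mulVec, h, inner_ketBra, hφ]
    simp
  rw [Finset.sum_eq_zero_iff_of_nonneg fun _ _ => by positivity] at hsum
  simpa using hsum i (Finset.mem_univ i)

end KetBra

/-! ### The roof with bounded ranks and its monotonicity. -/

section Roof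

open scoped Pointwise

variable {N : ℕ} {d : Fin N → ℕ} {k : Fin N → ℕ}

/-- The numbers `∑ i, ‖Γ i (ψ i)‖²` over the pure-state ensembles `ψ` of `ρ` and the tensor
products `Γ i` of local projectors of ranks at most `k`. No relation between `k` and the local
dimensions is assumed. -/
def boundedRoofValues (k : Fin N → ℕ) (ρ : Operator d) : Set ℝ :=
  {r | ∃ (n : ℕ) (ψ : Fin n → PureState d)
    (Γ : Fin n → (q : Fin N) → Matrix (Fin (d q)) (Fin (d q)) ℂ),
    ∑ i, ketBra (ψ i) = ρ ∧ (∀ i, Γ i ∈ localProjectors (fun q => Finset.Iic (k q)) d) ∧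
    r = ∑ i, ‖Matrix.toEuclideanLin (tensorOp (Γ i)) (ψ i)‖ ^ 2}

/-- The extension of `mixedE k` to systems of arbitrary local dimensions. -/
noncomputable def boundedE (k : Fin N → ℕ) (ρ : Operator d) : ℝ := sSup (boundedRoofValues k ρ)

theorem sum_mem_boundedRoofValues {ι : Type*} [Fintype ι] {ρ : Operator d} (ψ : ι → PureState d)
    (Γ : ι → (q : Fin N) → Matrix (Fin (d q)) (Fin (d q)) ℂ) (hψ : ∑ i, ketBra (ψ i) = ρ)
    (hΓ : ∀ i, Γ i ∈ localProjectors (fun q => Finset.Iic (k q)) d) :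
    ∑ i, ‖Matrix.toEuclideanLin (tensorOp (Γ i)) (ψ i)‖ ^ 2 ∈ boundedRoofValues k ρ := by
  let f := (Fintype.equivFin ι).symm
  refine ⟨_, ψ ∘ f, Γ ∘ f, ?_, fun i => hΓ _, ?_⟩
  · rw [← hψ, ← f.sum_comp]
    rfl
  · rw [← f.sum_comp]
    rfl

theorem norm_tensorOp_sq_le {s : Fin N → Finset ℕ}
    {Γ : (q : Fin N) → Matrix (Fin (d q)) (Fin (d q)) ℂ} (hΓ : Γ ∈ localProjectors s d)
    (ψ : PureState d) : ‖Matrix.toEuclideanLin (tensorOp Γ) ψ‖ ^ 2 ≤ ‖ψ‖ ^ 2 :=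
  norm_toEuclideanLin_proj_le (isStarProjection_tensorOp fun q => (hΓ q).1) ψ

theorem boundedRoofValues_subset (ρ : Operator d) :
    boundedRoofValues k ρ ⊆ Set.Icc 0 ρ.trace.re := by
  rintro _ ⟨n, ψ, Γ, hψ, hΓ, rfl⟩
  rw [re_trace_eq_sum hψ]
  exact ⟨by positivity, Finset.sum_le_sum fun i _ => norm_tensorOp_sq_le (hΓ i) _⟩

theorem bddAbove_boundedRoofValues (ρ : Operator d) : BddAbove (boundedRoofValues k ρ) :=
  bddAbove_Icc.mono (boundedRoofValues_subset ρ)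

theorem zero_mem_localProjectors (k d : Fin N → ℕ) :
    0 ∈ localProjectors (fun q => Finset.Iic (k q)) d :=
  fun q => ⟨IsStarProjection.zero _, by simp⟩

theorem Matrix.PosSemidef.boundedRoofValues_nonempty {ρ : Operator d} (hρ : ρ.PosSemidef) :
    (boundedRoofValues k ρ).Nonempty := by
  obtain ⟨n, ψ, hψ⟩ := hρ.exists_sum_ketBra
  exact ⟨_, sum_mem_boundedRoofValues ψ _ hψ fun _ => zero_mem_localProjectors k d⟩

/-- Decompositions of `ρ` and of `σ` concatenate to one of `ρ + σ`. -/
theorem boundedE_add_le {ρ σ : Operator d} (hρ : ρ.PosSemidef) (hσ : σ.PosSemidef) :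
    boundedE k ρ + boundedE k σ ≤ boundedE k (ρ + σ) := by
  rw [boundedE, boundedE, ← csSup_add hρ.boundedRoofValues_nonempty
    (bddAbove_boundedRoofValues ρ) hσ.boundedRoofValues_nonempty (bddAbove_boundedRoofValues σ)]
  refine csSup_le_csSup (bddAbove_boundedRoofValues _)
    (hρ.boundedRoofValues_nonempty.add hσ.boundedRoofValues_nonempty) ?_
  rintro _ ⟨_, ⟨n, ψ, Γ, hψ, hΓ, rfl⟩, _, ⟨m, χ, Δ, hχ, hΔ, rfl⟩, rfl⟩
  have := sum_mem_boundedRoofValues (k := k) (ρ := ρ + σ) (Sum.elim ψ χ) (Sum.elim Γ Δ)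
    (by rw [Fintype.sum_sum_type, ← hψ, ← hχ]; rfl)
    (by rintro (i | i); exacts [hΓ i, hΔ i])
  simpa only [Fintype.sum_sum_type, Sum.elim_inl, Sum.elim_inr] using this

theorem LocalInstrument.post_sum_ketBra {p : Fin N} (I : LocalInstrument (d p)) {ι : Type*}
    [Fintype ι] (ψ : ι → PureState d) (m : Fin I.outcomes) :
    I.post (∑ i, ketBra (ψ i)) m = ∑ x : ι × Fin (I.krausCount m),
      ketBra (Matrix.toEuclideanLin (onParty p (I.kraus m x.2)) (ψ x.1)) := by
  rw [LocalInstrument.post, Fintype.sum_prod_type, Finset.sum_comm]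
  refine Finset.sum_congr rfl fun s _ => ?_
  rw [Matrix.mul_sum, Matrix.sum_mul]
  exact Finset.sum_congr rfl fun i _ => mul_ketBra_mul_conjTranspose _ _

theorem LocalInstrument.posSemidef_post {p : Fin N} (I : LocalInstrument (d p)) {ρ : Operator d}
    (hρ : ρ.PosSemidef) (m : Fin I.outcomes) : (I.post ρ m).PosSemidef :=
  Matrix.posSemidef_sum _ fun _ _ => hρ.mul_mul_conjTranspose_same _

theorem boundedE_le_sum_post {p : Fin N} (I : LocalInstrument (d p)) {ρ : Operator d}
    (hρ : ρ.PosSemidef) : boundedE k ρ ≤ ∑ m, boundedE k (I.post ρ m) := by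
  refine csSup_le hρ.boundedRoofValues_nonempty ?_
  rintro _ ⟨n, ψ, Γ, rfl, hΓ, rfl⟩
  -- All Kraus operators together form one fine-grained measurement. Its results for a fixed `m` are
  -- then collected into a decomposition of `I.post ρ m`.
  have hA : ∑ x : (m : Fin I.outcomes) × Fin (I.krausCount m),
      (I.kraus x.1 x.2)ᴴ * I.kraus x.1 x.2 = 1 := by
    rw [Fintype.sum_sigma]
    exact I.complete
  choose Δ hΔ hle using fun i => exists_localProjectors_sum_ge hA (ψ i) (hΓ i)
  refine (Finset.sum_le_sum fun i _ => hle i).trans ?_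
  simp_rw [Fintype.sum_sigma]
  rw [Finset.sum_comm]
  refine Finset.sum_le_sum fun m _ => ?_
  rw [← Fintype.sum_prod_type' (f := fun (i : Fin n) (s : Fin (I.krausCount m)) =>
    ‖Matrix.toEuclideanLin (tensorOp (Δ i ⟨m, s⟩))
      (Matrix.toEuclideanLin (onParty p (I.kraus m s)) (ψ i))‖ ^ 2)]
  exact le_csSup (bddAbove_boundedRoofValues _) (sum_mem_boundedRoofValues
    (fun x : Fin n × Fin (I.krausCount m) =>
      Matrix.toEuclideanLin (onParty p (I.kraus m x.2)) (ψ x.1))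
    (fun x => Δ x.1 ⟨m, x.2⟩) (I.post_sum_ketBra ψ m).symm fun x => hΔ _ _)

/-- Monotonicity of the extension of `E_k`, and preservation of positivity, under LOCC. -/
theorem LOCC.isPos_and_sum_boundedE_le {S T : Ensemble N} (h : LOCC S T) (hS : S.IsPos) :
    T.IsPos ∧ (S.map fun s => boundedE k s.2).sum ≤ (T.map fun s => boundedE k s.2).sum := by
  induction h with
  | refl S => exact ⟨hS, le_rfl⟩
  | trans _ _ ih₁ ih₂ => exact ⟨(ih₂ (ih₁ hS).1).1, (ih₁ hS).2.trans (ih₂ (ih₁ hS).1).2⟩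
  | operate ρ S p I =>
    have hρ : ρ.PosSemidef := hS ⟨_, ρ⟩ (by simp [Ensemble.single])
    refine ⟨fun s hs => ?_, ?_⟩
    · rcases Multiset.mem_add.1 hs with hs | hs
      · obtain ⟨m, -, rfl⟩ := Multiset.mem_map.1 hs
        exact I.posSemidef_post hρ m
      · exact hS s (Multiset.mem_add.2 (.inr hs))
    · simp only [Multiset.map_add, Multiset.sum_add, Ensemble.single, Multiset.map_singleton,
        Multiset.sum_singleton, LocalInstrument.run, Multiset.map_map]
      exact add_le_add_left (boundedE_le_sum_post I hρ) _
  | forget ρ σ S =>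
    have hρ : ρ.PosSemidef := hS ⟨_, ρ⟩ (by simp [Ensemble.single])
    have hσ : σ.PosSemidef := hS ⟨_, σ⟩ (by simp [Ensemble.single])
    refine ⟨fun s hs => ?_, ?_⟩
    · rcases Multiset.mem_add.1 hs with hs | hs
      · rw [Multiset.mem_singleton.1 hs]
        exact hρ.add hσ
      · exact hS s (Multiset.mem_add.2 (.inr hs))
    · simp only [Multiset.map_add, Multiset.sum_add, Ensemble.single, Multiset.map_singleton,
        Multiset.sum_singleton]
      exact add_le_add_left (boundedE_add_le hρ hσ) _

/-! ### Attainment of the roof. -/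

theorem continuous_norm_tensorOp_sq {X : Type*} [TopologicalSpace X] {f : X → PureState d}
    {g : X → (q : Fin N) → Matrix (Fin (d q)) (Fin (d q)) ℂ} (hf : Continuous f)
    (hg : Continuous g) :
    Continuous fun x => ‖Matrix.toEuclideanLin (tensorOp (g x)) (f x)‖ ^ 2 := by
  have h : Continuous fun x => tensorOp (g x) := by
    refine continuous_matrix fun x y => ?_
    simp only [tensorOp, Matrix.of_apply]
    exact continuous_finsetProd _ fun q _ => ((continuous_apply q).comp hg).matrix_elem _ _
  simp only [Matrix.toLpLin_apply]
  exact ((PiLp.continuous_toLp 2 _).comp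
    (h.matrix_mulVec ((PiLp.continuous_ofLp 2 _).comp hf))).norm.pow 2

/-- The pairs `(|ψ⟩⟨ψ|, ‖Γ ψ‖²)` in which the squared norm of `ψ` is at most `t`. -/
def boundedGraph (k d : Fin N → ℕ) (t : ℝ) : Set (Operator d × ℝ) :=
  (fun z => (ketBra z.1, ‖Matrix.toEuclideanLin (tensorOp z.2) z.1‖ ^ 2)) ''
    (Metric.closedBall (0 : PureState d) √t ×ˢ localProjectors (fun q => Finset.Iic (k q)) d)

theorem isCompact_boundedGraph (k d : Fin N → ℕ) (t : ℝ) : IsCompact (boundedGraph k d t) :=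
  ((isCompact_closedBall _ _).prod (isCompact_localProjectors _ _)).image
    ((continuous_ketBra.comp continuous_fst).prodMk
      (continuous_norm_tensorOp_sq continuous_fst continuous_snd))

/-- Both coordinates of the graph are quadratic in `ψ`, so weights and lengths can be exchanged.
Every decomposition has total squared norm `t`; hence `‖ψ i‖ ^ 2 / t` are convex weights once the
nonzero members are rescaled to norm `√t`. Conversely, a weight `w i` is absorbed as a factor `√(w
i)`. -/
theorem mem_boundedRoofValues_iff {ρ : Operator d} (hρ : 0 < ρ.trace.re) {r : ℝ} :
    r ∈ boundedRoofValues k ρ ↔ (ρ, r) ∈ convexHull ℝ (boundedGraph k d ρ.trace.re) := by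
  set t := ρ.trace.re
  constructor
  · rintro ⟨n, ψ, Γ, hψ, hΓ, rfl⟩
    -- A zero member gets weight `0` and, since division by zero gives `0`, stays the zero vector;
    -- this is one reason for the ball instead of the sphere in `boundedGraph`.
    have hw (i : Fin n) : (‖ψ i‖ ^ 2 / t) * (√t / ‖ψ i‖) ^ 2 * ‖ψ i‖ ^ 2 = ‖ψ i‖ ^ 2 := by
      rcases eq_or_ne ‖ψ i‖ 0 with h | h
      · simp [h]
      · field_simp
        rw [Real.sq_sqrt hρ.le]
    have hs (i : Fin n) : ψ i ≠ 0 → (‖ψ i‖ ^ 2 / t) * (√t / ‖ψ i‖) ^ 2 = 1 := by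
      intro h
      have : ‖ψ i‖ ^ 2 ≠ 0 := by simpa using h
      exact mul_right_cancel₀ this ((hw i).trans (one_mul _).symm)
    refine mem_convexHull_of_exists_fintype (fun i => ‖ψ i‖ ^ 2 / t)
      (fun i => (ketBra ((√t / ‖ψ i‖) • ψ i),
        ‖Matrix.toEuclideanLin (tensorOp (Γ i)) ((√t / ‖ψ i‖) • ψ i)‖ ^ 2))
      (fun i => by positivity) ?_ (fun i => ⟨(_, Γ i), ⟨?_, hΓ i⟩, rfl⟩) ?_
    · rw [← Finset.sum_div, ← re_trace_eq_sum hψ, div_self hρ.ne']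
    · rw [mem_closedBall_zero_iff, norm_smul, Real.norm_of_nonneg (by positivity)]
      rcases eq_or_ne ‖ψ i‖ 0 with h | h
      · simp [h]
      · rw [div_mul_cancel₀ _ h]
    · refine Prod.ext ?_ ?_
      · rw [Prod.fst_sum, ← hψ]
        refine Finset.sum_congr rfl fun i _ => ?_
        rw [Prod.smul_fst, ketBra_real_smul, smul_smul]
        by_cases h : ψ i = 0
        · have : ketBra (ψ i) = 0 := by rw [h]; ext; simp [ketBra, Matrix.vecMulVec_apply]
          rw [this, smul_zero]
        · rw [hs i h, one_smul]
      · rw [Prod.snd_sum]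
        refine Finset.sum_congr rfl fun i _ => ?_
        rw [Prod.smul_snd, ← Complex.coe_smul, map_smul, norm_smul, Complex.norm_real,
          Real.norm_of_nonneg (by positivity), smul_eq_mul, mul_pow, ← mul_assoc]
        by_cases h : ψ i = 0
        · simp [h]
        · rw [hs i h, one_mul]
  · intro h
    obtain ⟨ι, _, w, z, hw, -, hz, hsum⟩ := mem_convexHull_iff_exists_fintype.1 h
    choose y hy hyz using hz
    have h1 := congrArg Prod.fst hsum
    have h2 := congrArg Prod.snd hsum
    rw [Prod.fst_sum] at h1
    rw [Prod.snd_sum] at h2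
    convert sum_mem_boundedRoofValues (k := k) (fun i => √(w i) • (y i).1) (fun i => (y i).2) ?_
      (fun i => (hy i).2) using 1
    · refine h2.symm.trans ?_
      refine Finset.sum_congr rfl fun i _ => ?_
      rw [← hyz, Prod.smul_snd, ← Complex.coe_smul, map_smul, norm_smul, Complex.norm_real,
        Real.norm_of_nonneg (Real.sqrt_nonneg _), mul_pow, Real.sq_sqrt (hw i), smul_eq_mul]
    · refine Eq.trans ?_ h1
      refine Finset.sum_congr rfl fun i _ => ?_
      rw [← hyz, Prod.smul_fst, ketBra_real_smul, Real.sq_sqrt (hw i)]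

/-- The number of members is unbounded, so compactness comes from the convex hull. Trace zero is
separate: there the only value is `0`. -/
theorem Matrix.PosSemidef.isGreatest_boundedE {ρ : Operator d} (hρ : ρ.PosSemidef) :
    IsGreatest (boundedRoofValues k ρ) (boundedE k ρ) := by
  have hne := hρ.boundedRoofValues_nonempty (k := k)
  refine ⟨IsClosed.csSup_mem ?_ hne (bddAbove_boundedRoofValues ρ),
    fun r hr => le_csSup (bddAbove_boundedRoofValues ρ) hr⟩
  obtain ⟨r, hr⟩ := hne
  have hsub := boundedRoofValues_subset (k := k) ρ
  rcases (hsub hr).1.trans (hsub hr).2 |>.eq_or_lt with h0 | hpos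
  · rw [← h0, Set.Icc_self] at hsub
    exact ((Set.finite_singleton _).subset hsub).isClosed
  · have : boundedRoofValues k ρ =
        (fun r => (ρ, r)) ⁻¹' convexHull ℝ (boundedGraph k d ρ.trace.re) :=
      Set.ext fun r => mem_boundedRoofValues_iff hpos
    rw [this]
    exact (isCompact_boundedGraph k d _).convexHull_of_finiteDimensional.isClosed.preimage
      (by fun_prop)

/-! ### Return to exact ranks, pure states and weights. -/

theorem projectionValues_eq_image (ψ : PureState d) : projectionValues k ψ =
    (fun Γ => ‖Matrix.toEuclideanLin (tensorOp Γ) ψ‖ ^ 2) ''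
      localProjectors (fun q => {k q}) d := by
  ext r
  simp only [projectionValues, localProjectors, Finset.mem_singleton, Set.mem_image,
    Set.mem_ofPred_eq, eq_comm]

theorem exists_localProjectors_eq (hkd : ∀ q, k q ≤ d q)
    {Γ : (q : Fin N) → Matrix (Fin (d q)) (Fin (d q)) ℂ}
    (hΓ : Γ ∈ localProjectors (fun q => Finset.Iic (k q)) d) :
    ∃ Δ ∈ localProjectors (fun q => {k q}) d, ∀ q, Γ q * Δ q = Γ q := by
  choose Δ hΔ hr hm using fun q => Matrix.exists_proj_rank_eq (hΓ q).1
    (Finset.mem_Iic.1 (hΓ q).2) ((hkd q).trans_eq (Fintype.card_fin _).symm)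
  exact ⟨Δ, fun q => ⟨hΔ q, Finset.mem_singleton.2 (hr q)⟩, hm⟩

theorem isGreatest_pureE (hkd : ∀ q, k q ≤ d q) (ψ : PureState d) :
    IsGreatest (projectionValues k ψ) (pureE k ψ) := by
  have hc : IsCompact (projectionValues k ψ) := by
    rw [projectionValues_eq_image]
    exact (isCompact_localProjectors _ d).image
      (continuous_norm_tensorOp_sq continuous_const continuous_id)
  have hne : (projectionValues k ψ).Nonempty := by
    obtain ⟨Δ, hΔ, -⟩ := exists_localProjectors_eq hkd (zero_mem_localProjectors k d)
    rw [projectionValues_eq_image]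
    exact ⟨_, Δ, hΔ, rfl⟩
  exact hc.isGreatest_sSup hne

theorem exists_localProjectors_pureE_eq (hkd : ∀ q, k q ≤ d q) (ψ : PureState d) :
    ∃ Γ ∈ localProjectors (fun q => Finset.Iic (k q)) d,
      pureE k ψ = ‖Matrix.toEuclideanLin (tensorOp Γ) ψ‖ ^ 2 := by
  obtain ⟨Γ, hΓ, h⟩ := (isGreatest_pureE hkd ψ).1
  exact ⟨Γ, fun q => ⟨(hΓ q).1, Finset.mem_Iic.2 (hΓ q).2.le⟩, h⟩

theorem norm_tensorOp_sq_le_pureE (hkd : ∀ q, k q ≤ d q) (ψ : PureState d)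
    {Γ : (q : Fin N) → Matrix (Fin (d q)) (Fin (d q)) ℂ}
    (hΓ : Γ ∈ localProjectors (fun q => Finset.Iic (k q)) d) :
    ‖Matrix.toEuclideanLin (tensorOp Γ) ψ‖ ^ 2 ≤ pureE k ψ := by
  obtain ⟨Δ, hΔ, hm⟩ := exists_localProjectors_eq hkd hΓ
  refine (norm_tensorOp_le_of_mul_eq (fun q => (hΓ q).1) hm ψ).trans
    ((isGreatest_pureE hkd ψ).2 ?_)
  rw [projectionValues_eq_image]
  exact ⟨Δ, hΔ, rfl⟩

theorem roofValues_subset (hkd : ∀ q, k q ≤ d q) (ρ : Operator d) :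
    roofValues k ρ ⊆ boundedRoofValues k ρ := by
  rintro _ ⟨n, ψ, hψ, rfl⟩
  choose Γ hΓ h using fun i => exists_localProjectors_pureE_eq hkd (ψ i)
  exact ⟨n, ψ, Γ, hψ, hΓ, Finset.sum_congr rfl fun i _ => h i⟩

/-- In an optimal decomposition for bounded ranks, replacing each projector value by `pureE` cannot
lower the sum, and the result is still a bounded-rank value. -/
theorem Matrix.PosSemidef.isGreatest_roofValues_boundedE (hkd : ∀ q, k q ≤ d q) {ρ : Operator d}
    (hρ : ρ.PosSemidef) : IsGreatest (roofValues k ρ) (boundedE k ρ) := by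
  have hg := hρ.isGreatest_boundedE (k := k)
  obtain ⟨n, ψ, Γ, hψ, hΓ, h⟩ := hg.1
  have hmem : ∑ i, pureE k (ψ i) ∈ roofValues k ρ := ⟨n, ψ, hψ, rfl⟩
  have heq : boundedE k ρ = ∑ i, pureE k (ψ i) := by
    refine le_antisymm ?_ (hg.2 (roofValues_subset hkd ρ hmem))
    rw [h]
    exact Finset.sum_le_sum fun i _ => norm_tensorOp_sq_le_pureE hkd _ (hΓ i)
  exact ⟨heq ▸ hmem, fun r hr => hg.2 (roofValues_subset hkd ρ hr)⟩

theorem Matrix.PosSemidef.mixedE_eq_boundedE (hkd : ∀ q, k q ≤ d q) {ρ : Operator d}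
    (hρ : ρ.PosSemidef) : mixedE k ρ = boundedE k ρ :=
  (hρ.isGreatest_roofValues_boundedE hkd).csSup_eq

theorem Matrix.PosSemidef.isGreatest_mixedE (hkd : ∀ q, k q ≤ d q) {ρ : Operator d}
    (hρ : ρ.PosSemidef) : IsGreatest (roofValues k ρ) (mixedE k ρ) :=
  hρ.mixedE_eq_boundedE hkd ▸ hρ.isGreatest_roofValues_boundedE hkd

theorem projectionValues_smul (c : ℂ) (ψ : PureState d) :
    projectionValues k (c • ψ) = ‖c‖ ^ 2 • projectionValues k ψ := by
  simp only [projectionValues_eq_image, ← Set.image_smul, Set.image_image, map_smul, norm_smul,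
    mul_pow, smul_eq_mul]

theorem pureE_smul (c : ℂ) (ψ : PureState d) : pureE k (c • ψ) = ‖c‖ ^ 2 * pureE k ψ := by
  rw [pureE, projectionValues_smul, Real.sSup_smul_of_nonneg (by positivity), smul_eq_mul, pureE]

/-- Every decomposition of `ketBra ψ` consists of multiples `c i • ψ`; for `ψ ≠ 0` the trace forces
`∑ i, ‖c i‖ ^ 2 = 1`, and `pureE` is quadratic. -/
theorem mixedE_ketBra (hkd : ∀ q, k q ≤ d q) (ψ : PureState d) :
    mixedE k (ketBra ψ) = pureE k ψ := by
  have hg := (posSemidef_ketBra ψ).isGreatest_mixedE hkd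
  refine le_antisymm ?_ (hg.2 ⟨1, fun _ => ψ, by simp, by simp⟩)
  obtain ⟨n, χ, hχ, h⟩ := hg.1
  choose c hc using exists_smul_of_sum_ketBra_eq hχ
  rw [h]
  simp only [hc, pureE_smul, ← Finset.sum_mul]
  by_cases hψ : ψ = 0
  · have : pureE k ψ = 0 := by
      simpa [← hψ] using pureE_smul (k := k) 0 ψ
    simp [this]
  · have htr := re_trace_eq_sum hχ
    rw [trace_ketBra, Complex.ofReal_re] at htr
    simp only [hc, norm_smul, mul_pow, ← Finset.sum_mul] at htr
    have : ∑ i, ‖c i‖ ^ 2 = 1 := by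
      have h0 : ‖ψ‖ ^ 2 ≠ 0 := by simpa using hψ
      exact mul_right_cancel₀ h0 (htr.symm.trans (one_mul _).symm)
    rw [this, one_mul]

theorem roofValues_smul_subset (c : ℝ) (ρ : Operator d) :
    c ^ 2 • roofValues k ρ ⊆ roofValues k (c ^ 2 • ρ) := by
  rintro _ ⟨_, ⟨n, ψ, rfl, rfl⟩, rfl⟩
  refine ⟨n, fun i => c • ψ i, ?_, ?_⟩
  · simp only [ketBra_real_smul, Finset.smul_sum]
  · simp only [← Complex.coe_smul, pureE_smul, Complex.norm_real, Real.norm_eq_abs, sq_abs,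
      ← Finset.mul_sum]
    simp

theorem roofValues_smul {c : ℝ} (hc : c ≠ 0) (ρ : Operator d) :
    roofValues k (c ^ 2 • ρ) = c ^ 2 • roofValues k ρ := by
  have hc2 : c ^ 2 ≠ 0 := pow_ne_zero 2 hc
  refine Set.Subset.antisymm ?_ (roofValues_smul_subset c ρ)
  rw [← Set.smul_set_subset_smul_set_iff₀ (a := c⁻¹ ^ 2) (by simpa using hc),
    smul_smul, ← mul_pow, inv_mul_cancel₀ hc, one_pow, one_smul]
  refine (roofValues_smul_subset _ _).trans_eq ?_
  rw [smul_smul, ← mul_pow, inv_mul_cancel₀ hc, one_pow, one_smul]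

theorem mixedE_smul (hkd : ∀ q, k q ≤ d q) (p : ℝ≥0) (ρ : Operator d) :
    mixedE k (((p : ℝ) : ℂ) • ρ) = p * mixedE k ρ := by
  rw [Complex.coe_smul]
  -- Rescaling decompositions is invertible only for `p ≠ 0`; for `p = 0` the operator is `ketBra
  -- 0`, of value `0`.
  rcases eq_or_ne p 0 with rfl | hp
  · have := pureE_smul (k := k) (0 : ℂ) (0 : PureState d)
    have h0 : ketBra (0 : PureState d) = 0 := by
      ext
      simp [ketBra, Matrix.vecMulVec_apply]
    have := mixedE_ketBra hkd (0 : PureState d)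
    simp_all
  · have h : (p : ℝ) = √p ^ 2 := (Real.sq_sqrt p.2).symm
    have hs : √(p : ℝ) ≠ 0 := by
      exact (Real.sqrt_ne_zero p.2).2 (NNReal.coe_ne_zero.2 hp)
    rw [h, mixedE, roofValues_smul hs, Real.sSup_smul_of_nonneg (by positivity), smul_eq_mul,
      mixedE]

theorem WeightedEnsemble.E_toEnsemble (S : WeightedEnsemble N) (hS : S.toEnsemble.Admits k) :
    S.toEnsemble.E k = S.E k := by
  rw [Ensemble.E, WeightedEnsemble.toEnsemble, Multiset.map_map, WeightedEnsemble.E]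
  refine congrArg Multiset.sum (Multiset.map_congr rfl fun s hs => ?_)
  exact mixedE_smul (hS ⟨s.2.1, _⟩ (Multiset.mem_map_of_mem _ hs)) _ _

theorem Ensemble.IsPos.E_eq_sum_boundedE {S : Ensemble N} (hS : S.IsPos) (hk : S.Admits k) :
    S.E k = (S.map fun s => boundedE k s.2).sum :=
  congrArg Multiset.sum (Multiset.map_congr rfl fun s hs =>
    (hS s hs).mixedE_eq_boundedE (hk s hs))

theorem LOCC.E_le {S T : Ensemble N} (h : LOCC S T) (hS : S.IsPos) (hSk : S.Admits k)
    (hTk : T.Admits k) : S.E k ≤ T.E k := by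
  obtain ⟨hT, hle⟩ := h.isPos_and_sum_boundedE_le (k := k) hS
  rwa [hS.E_eq_sum_boundedE hSk, hT.E_eq_sum_boundedE hTk]

theorem LOCC.mixedE_le {e : Fin N → ℕ} {ρ : Operator d} {σ : Operator e}
    (h : LOCC (Ensemble.single ρ) (Ensemble.single σ)) (hρ : ρ.PosSemidef)
    (hd : ∀ q, k q ≤ d q) (he : ∀ q, k q ≤ e q) : mixedE k ρ ≤ mixedE k σ := by
  have := h.E_le (k := k) (fun s hs => by rwa [Multiset.mem_singleton.1 hs])
    (fun s hs => by rwa [Multiset.mem_singleton.1 hs])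
    (fun s hs => by rwa [Multiset.mem_singleton.1 hs])
  simpa [Ensemble.E, Ensemble.single] using this

end Roof

theorem mainTheorem1 (N : ℕ) (k : Fin N → ℕ) (hk : ∀ q, 1 ≤ k q) :
    -- the maxima in the definitions of `E_k` exist, and both definitions agree on pure states
    (∀ (d : Fin N → ℕ), (∀ q, k q ≤ d q) →
      (∀ ψ : PureState d, IsGreatest (projectionValues k ψ) (pureE k ψ)) ∧
      (∀ ρ : Operator d, ρ.PosSemidef → IsGreatest (roofValues k ρ) (mixedE k ρ)) ∧
      (∀ ψ : PureState d, mixedE k (ketBra ψ) = pureE k ψ)) ∧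
    -- pure states to pure states
    (∀ (d e : Fin N → ℕ), (∀ q, k q ≤ d q) → (∀ q, k q ≤ e q) →
      ∀ (ψ : PureState d) (φ : PureState e),
        LOCC (Ensemble.single (ketBra ψ)) (Ensemble.single (ketBra φ)) →
        pureE k ψ ≤ pureE k φ) ∧
    -- mixed states to mixed states
    (∀ (d e : Fin N → ℕ), (∀ q, k q ≤ d q) → (∀ q, k q ≤ e q) →
      ∀ (ρ : Operator d) (σ : Operator e), ρ.PosSemidef →
        LOCC (Ensemble.single ρ) (Ensemble.single σ) → mixedE k ρ ≤ mixedE k σ) ∧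
    -- ensembles of unnormalized states to ensembles of unnormalized states
    (∀ S T : Ensemble N, S.IsPos → S.Admits k → T.Admits k → LOCC S T → S.E k ≤ T.E k) ∧
    -- ensembles with explicit probabilities
    (∀ S T : WeightedEnsemble N, (∀ s ∈ S, s.2.2.PosSemidef) →
      S.toEnsemble.Admits k → T.toEnsemble.Admits k →
      LOCC S.toEnsemble T.toEnsemble → S.E k ≤ T.E k) := by
  refine ⟨fun d hd => ⟨isGreatest_pureE hd, fun ρ hρ => hρ.isGreatest_mixedE hd,
    mixedE_ketBra hd⟩, fun d e hd he ψ φ h => ?_,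
    fun d e hd he ρ σ hρ h => h.mixedE_le hρ hd he,
    fun S T hS hSk hTk h => h.E_le hS hSk hTk, fun S T hS hSk hTk h => ?_⟩
  · rw [← mixedE_ketBra hd, ← mixedE_ketBra he]
    exact h.mixedE_le (posSemidef_ketBra ψ) hd he
  · rw [← S.E_toEnsemble hSk, ← T.E_toEnsemble hTk]
    refine h.E_le (fun s hs => ?_) hSk hTk
    obtain ⟨s, hs, rfl⟩ := Multiset.mem_map.1 hs
    exact (hS s ‹_›).smul (Complex.zero_le_real.2 s.1.2)
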